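/- Let $G$ be a directed graph on $n\ge 1$ vertices (self-loops allowed) that is ergodic, i.e. strongly connected and aperiodic (for every vertex, the lengths of the closed walks of positive length through it have greatest common divisor $1$). Let $\mathbf A\in\{0,1\}^{n\times n}$ be its adjacency matrix, $\mathbf D$ the diagonal matrix with $d_{ii}=|\{j: a_{ij}=1\}|$, $\mathbf\Delta_{\mathrm{rw}}=\mathbf I_n-\mathbf D^{-1}\mathbf A$ and $E_{\mathrm{rw}}(\mathbf X)=\operatorname{tr}(\mathbf X^T\mathbf\Delta_{\mathrm{rw}}\mathbf X)$ for $\mathbf X\in\mathbb R^{n\times d}$. Let $\tilde{\mathbf A}^{(0)},\tilde{\mathbf A}^{(1)},\dots\in\mathbb R^{n\times n}$ be a (deterministic, time-varying) sequence of row-stochastic matrices representing $G$, i.e. $\tilde{\mathbf A}^{(k)}_{pq}\ne 0$ if and only if $a_{pq}=1$, and let $\epsilon>0$ be such that every non-zero entry of every $\tilde{\mathbf A}^{(k)}$ is at least $\epsilon$. For an initial state $\mathbf X^{(0)}\in\mathbb R^{n\times d}$ and feature transformations $\mathbf W^{(k)}\in\mathbb R^{d\times d}$ put $$\mathbf X^{(k+1)}=\tilde{\mathbf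 A}^{(k)}\mathbf X^{(k)}\mathbf W^{(k)},\qquad k\ge 0,$$ and read $\mathbf X/\lVert\mathbf X\rVert_F$ as $\mathbf 0$ if $\mathbf X=\mathbf 0$. (a) Let $\mathbf X^{(0)}$ be random with a law that is absolutely continuous with respect to the Lebesgue measure on $\mathbb R^{n\times d}$, and let $(\mathbf W^{(k)})_{k\ge0}$ be any sequence of random matrices, with any joint law, that is independent of $\mathbf X^{(0)}$ (in particular, any deterministic sequence of matrices). Then $$\operatorname*{plim}_{l\to\infty}E_{\mathrm{rw}}\left(\frac{\mathbf X^{(l)}}{\lVert\mathbf X^{(l)}\rVert_F}\right)=0 .$$ (b) There is a probability vector $\mathbf y\in\mathbb R^n$ with $\lim_{l\to\infty}\tilde{\mathbf A}^{(l-1)}\cdots\tilde{\mathbf A}^{(0)}=\mathbf 1\mathbf y^T$ such that the following holds. Let $\mathbf X^{(0)}$ be fixed with $\mathbf y^T\mathbf X^{(0)}\neq 0$, let $\mathbf W^{(0)}$ be random with a law that is absolutely continuous with respect to the Lebesgue measure on $\mathbb R^{d\times d}$, and let $(\mathbf W^{(k)})_{k\ge1}$ be any sequence of random matrices, with any joint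 law, that is independent of $\mathbf W^{(0)}$ (in particular, all $\mathbf W^{(k)}$ may be independent with absolutely continuous laws). Then again $$\operatorname*{plim}_{l\to\infty}E_{\mathrm{rw}}\left(\frac{\mathbf X^{(l)}}{\lVert\mathbf X^{(l)}\rVert_F}\right)=0 .$$ -/

import Mathlib

open MeasureTheory ProbabilityTheory Filter Topology
open scoped Matrix

noncomputable section

/-- Real matrices carry the product σ-algebra of their entries and, as `volume`, the Lebesgue
measure on the space of their entries. -/
instance Matrix.instMeasureSpaceReal (m n : ℕ) : MeasureSpace (Matrix (Fin m) (Fin n) ℝ) :=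
  inferInstanceAs (MeasureSpace (Fin m → Fin n → ℝ))

namespace Smoothing

/-- The binary adjacency matrix of a (possibly directed, possibly looped) graph. -/
def adjMatrix {n : ℕ} (G : Digraph (Fin n)) : Matrix (Fin n) (Fin n) ℝ :=
  open Classical in Matrix.of fun i j => if G.Adj i j then 1 else 0

/-- The degree matrix: the `i`-th diagonal entry is the number of `j` with an edge `(i, j)`. -/
def degMatrix {n : ℕ} (G : Digraph (Fin n)) : Matrix (Fin n) (Fin n) ℝ :=
  Matrix.diagonal fun i => (Nat.card {j // G.Adj i j} : ℝ)

/-- Every vertex has period one: the lengths of the closed walks of positive length through it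
have greatest common divisor one. The entry `(i, i)` of the `m`-th power of the adjacency matrix
counts the closed walks of length `m` at `i`. -/
def IsAperiodic {n : ℕ} (G : Digraph (Fin n)) : Prop :=
  ∀ i, Nat.setGcd {m : ℕ | 0 < m ∧ 0 < (adjMatrix G ^ m) i i} = 1

/-- An ergodic graph: irreducible (that is, strongly connected) and aperiodic. -/
def IsErgodic {n : ℕ} (G : Digraph (Fin n)) : Prop :=
  (adjMatrix G).IsIrreducible ∧ IsAperiodic G

/-- The random walk Laplacian `I - D⁻¹ A`. -/
def rwLaplacian {n : ℕ} (G : Digraph (Fin n)) : Matrix (Fin n) (Fin n) ℝ :=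
  1 - (degMatrix G)⁻¹ * adjMatrix G

/-- The random walk Dirichlet energy `tr (Xᵀ Δ X)`. -/
def rwEnergy {n d : ℕ} (G : Digraph (Fin n)) (X : Matrix (Fin n) (Fin d) ℝ) : ℝ :=
  (Xᵀ * rwLaplacian G * X).trace

open scoped Matrix.Norms.Frobenius in
/-- `X / ‖X‖` for the Frobenius norm (and `0` for `X = 0`). -/
def frobNormalize {n d : ℕ} (X : Matrix (Fin n) (Fin d) ℝ) : Matrix (Fin n) (Fin d) ℝ :=
  ‖X‖⁻¹ • X

/-- The representations `X⁽ᵏ⁺¹⁾ = Ã⁽ᵏ⁾ X⁽ᵏ⁾ W⁽ᵏ⁾`, started at `X⁽⁰⁾`. -/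
def features {n d : ℕ} (A : ℕ → Matrix (Fin n) (Fin n) ℝ) (W : ℕ → Matrix (Fin d) (Fin d) ℝ)
    (X₀ : Matrix (Fin n) (Fin d) ℝ) : ℕ → Matrix (Fin n) (Fin d) ℝ
  | 0 => X₀
  | k + 1 => A k * features A W X₀ k * W k

/-- The product `Ã⁽ˡ⁻¹⁾ ⋯ Ã⁽¹⁾ Ã⁽⁰⁾` of the first `l` aggregation matrices. -/
def aggProd {n : ℕ} (A : ℕ → Matrix (Fin n) (Fin n) ℝ) : ℕ → Matrix (Fin n) (Fin n) ℝ
  | 0 => 1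
  | k + 1 => A k * aggProd A k

end Smoothing

end

namespace Smoothing

/-! ### Ergodic graphs are primitive -/

lemma adjMatrix_nonneg {n : ℕ} (G : Digraph (Fin n)) (i j : Fin n) : 0 ≤ adjMatrix G i j := by
  classical
  simp only [adjMatrix, Matrix.of_apply]
  split_ifs <;> norm_num

lemma pow_add_apply_pos {ι : Type*} [Fintype ι] [DecidableEq ι] {M : Matrix ι ι ℝ}
    (hM : ∀ i j, 0 ≤ M i j) {a b : ℕ} {i j k : ι} (hij : 0 < (M ^ a) i j)
    (hjk : 0 < (M ^ b) j k) : 0 < (M ^ (a + b)) i k := by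
  rw [pow_add, Matrix.mul_apply]
  exact Finset.sum_pos' (fun x _ => mul_nonneg (Matrix.pow_apply_nonneg hM _ _ _)
    (Matrix.pow_apply_nonneg hM _ _ _)) ⟨j, Finset.mem_univ j, mul_pos hij hjk⟩

/-- Return times are closed under addition, and an additive submonoid of `ℕ` generated by a set of
gcd one contains all large integers. -/
lemma IsAperiodic.exists_forall_ge_pow_pos {n : ℕ} {G : Digraph (Fin n)} (hG : IsAperiodic G)
    (i : Fin n) : ∃ N, ∀ m ≥ N, 0 < (adjMatrix G ^ m) i i := by
  obtain ⟨N, hN⟩ := Nat.exists_mem_closure_of_ge {m : ℕ | 0 < m ∧ 0 < (adjMatrix G ^ m) i i}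
  refine ⟨N, fun m hm => ?_⟩
  have hmem := hN m hm (by rw [hG i]; exact one_dvd m)
  clear hm
  induction hmem using AddSubmonoid.closure_induction with
  | mem x hx => exact hx.2
  | zero => simp
  | add x y _ _ hx hy => exact pow_add_apply_pos (adjMatrix_nonneg G) hx hy

theorem IsErgodic.isPrimitive {n : ℕ} {G : Digraph (Fin n)} (hG : IsErgodic G) :
    (adjMatrix G).IsPrimitive := by
  have hnn := adjMatrix_nonneg G
  choose N hN using hG.2.exists_forall_ge_pow_pos
  choose k _ hk using (Matrix.isIrreducible_iff_exists_pow_pos hnn).1 hG.1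
  -- One exponent for all pairs: after reserving `k i j` steps from `i` to `j`, at least `N i`
  -- remain for a closed walk at `i`.
  refine ⟨hnn, (∑ i, N i) + (∑ i, ∑ j, k i j) + 1, Nat.succ_pos _, fun i j => ?_⟩
  have h1 : N i ≤ ∑ i, N i := Finset.single_le_sum (f := N) (by simp) (Finset.mem_univ i)
  have h2 : k i j ≤ ∑ j, k i j := Finset.single_le_sum (f := k i) (by simp) (Finset.mem_univ j)
  have h3 : ∑ j, k i j ≤ ∑ i, ∑ j, k i j :=
    Finset.single_le_sum (f := fun i => ∑ j, k i j) (by simp) (Finset.mem_univ i)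
  obtain ⟨c, hc⟩ : ∃ c, (∑ i, N i) + (∑ i, ∑ j, k i j) + 1 = c + k i j :=
    ⟨_, (Nat.sub_add_cancel (by omega)).symm⟩
  rw [hc]
  exact pow_add_apply_pos hnn (hN i c (by omega)) (hk i j)

/-! ### Convergence of products of stochastic matrices -/

lemma aggProd_mem {n : ℕ} {A : ℕ → Matrix (Fin n) (Fin n) ℝ}
    (hA : ∀ k, A k ∈ Matrix.rowStochastic ℝ (Fin n)) (l : ℕ) :
    aggProd A l ∈ Matrix.rowStochastic ℝ (Fin n) := by
  induction l with
  | zero => exact one_mem _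
  | succ l ih => exact mul_mem (hA l) ih

lemma aggProd_add {n : ℕ} (A : ℕ → Matrix (Fin n) (Fin n) ℝ) (s m : ℕ) :
    aggProd A (s + m) = aggProd (fun k => A (s + k)) m * aggProd A s := by
  induction m with
  | zero => simp [aggProd]
  | succ m ih => rw [← add_assoc, aggProd, ih, aggProd, Matrix.mul_assoc]

/-- A walk of length `m` contributes a product of `m` entries, each at least `ε`; all other terms
are nonnegative. -/
lemma pow_le_aggProd {n : ℕ} {G : Digraph (Fin n)} {A : ℕ → Matrix (Fin n) (Fin n) ℝ}
    (hA : ∀ k, A k ∈ Matrix.rowStochastic ℝ (Fin n)) {ε : ℝ} (hε : 0 ≤ ε)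
    (hAG : ∀ k p q, G.Adj p q → ε ≤ A k p q) (m : ℕ) (i j : Fin n)
    (hij : 0 < (adjMatrix G ^ m) i j) : ε ^ m ≤ aggProd A m i j := by
  induction m generalizing i with
  | zero =>
    rcases eq_or_ne i j with rfl | h
    · simp [aggProd]
    · simp [h] at hij
  | succ m ih =>
    rw [pow_succ', Matrix.mul_apply] at hij
    obtain ⟨k, -, hk⟩ := (Finset.sum_pos_iff_of_nonneg fun x _ =>
      mul_nonneg (adjMatrix_nonneg G i x)
        (Matrix.pow_apply_nonneg (adjMatrix_nonneg G) m x j)).1 hij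
    have hkj : 0 < (adjMatrix G ^ m) k j :=
      pos_of_mul_pos_right hk (adjMatrix_nonneg G i k)
    have hik : G.Adj i k := by
      by_contra h
      simp [adjMatrix, h] at hk
    rw [aggProd, Matrix.mul_apply, pow_succ']
    calc ε * ε ^ m ≤ A m i k * aggProd A m k j :=
          mul_le_mul (hAG m i k hik) (ih k hkj) (by positivity) (hε.trans (hAG m i k hik))
      _ ≤ _ := Finset.single_le_sum (f := fun k => A m i k * aggProd A m k j)
          (fun x _ => mul_nonneg ((hA m).1 i x) ((aggProd_mem hA m).1 x j)) (Finset.mem_univ k)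

section Oscillation

variable {ι : Type*} [Fintype ι] [DecidableEq ι] {B : Matrix ι ι ℝ}

lemma mulVec_le_of_mem_rowStochastic (hB : B ∈ Matrix.rowStochastic ℝ ι) {x : ι → ℝ} {c : ℝ}
    (hx : ∀ i, x i ≤ c) (i : ι) : (B *ᵥ x) i ≤ c := by
  calc (B *ᵥ x) i = ∑ j, B i j * x j := rfl
    _ ≤ ∑ j, B i j * c := Finset.sum_le_sum fun j _ => mul_le_mul_of_nonneg_left (hx j) (hB.1 i j)
    _ = c := by rw [← Finset.sum_mul, Matrix.sum_row_of_mem_rowStochastic hB, one_mul]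

lemma le_mulVec_of_mem_rowStochastic (hB : B ∈ Matrix.rowStochastic ℝ ι) {x : ι → ℝ} {c : ℝ}
    (hx : ∀ i, c ≤ x i) (i : ι) : c ≤ (B *ᵥ x) i := by
  calc c = ∑ j, B i j * c := by
        rw [← Finset.sum_mul, Matrix.sum_row_of_mem_rowStochastic hB, one_mul]
    _ ≤ ∑ j, B i j * x j :=
        Finset.sum_le_sum fun j _ => mul_le_mul_of_nonneg_left (hx j) (hB.1 i j)

/-- One entry below the maximum pulls every entry of `B *ᵥ x` below the maximum. -/
lemma mulVec_le_sub_of_mem_rowStochastic (hB : B ∈ Matrix.rowStochastic ℝ ι) {δ : ℝ}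
    (hδ : ∀ i j, δ ≤ B i j) {x : ι → ℝ} {c : ℝ} (hx : ∀ i, x i ≤ c) (i k : ι) :
    (B *ᵥ x) i ≤ c - δ * (c - x k) := by
  have h : B i k * (c - x k) ≤ ∑ j, B i j * (c - x j) :=
    Finset.single_le_sum (f := fun j => B i j * (c - x j))
      (fun j _ => mul_nonneg (hB.1 i j) (sub_nonneg.2 (hx j))) (Finset.mem_univ k)
  have h' : ∑ j, B i j * (c - x j) = c - (B *ᵥ x) i := by
    simp only [mul_sub, Finset.sum_sub_distrib, ← Finset.sum_mul,
      Matrix.sum_row_of_mem_rowStochastic hB, one_mul]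
    rfl
  have := mul_le_mul_of_nonneg_right (hδ i k) (sub_nonneg.2 (hx k))
  linarith

variable [Nonempty ι]

/-- Every row puts weight at least `δ` on the minimizer of `x`, which lowers the maximum by `δ`
times the oscillation, while the minimum cannot drop. -/
lemma iSup_sub_iInf_mulVec_le (hB : B ∈ Matrix.rowStochastic ℝ ι) {δ : ℝ}
    (hδ : ∀ i j, δ ≤ B i j) (x : ι → ℝ) :
    (⨆ i, (B *ᵥ x) i) - ⨅ i, (B *ᵥ x) i ≤ (1 - δ) * ((⨆ i, x i) - ⨅ i, x i) := by
  obtain ⟨k, hk⟩ := exists_eq_ciInf_of_finite (f := x)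
  have h1 : (⨆ i, (B *ᵥ x) i) ≤ (⨆ i, x i) - δ * ((⨆ i, x i) - ⨅ i, x i) := by
    refine ciSup_le fun i => ?_
    rw [← hk]
    exact mulVec_le_sub_of_mem_rowStochastic hB hδ (le_ciSup (Set.finite_range x).bddAbove) i k
  have h2 : (⨅ i, x i) ≤ ⨅ i, (B *ᵥ x) i := le_ciInf fun i =>
    le_mulVec_of_mem_rowStochastic hB (ciInf_le (Set.finite_range x).bddBelow) i
  linarith

/-- A sequence of vectors, driven by stochastic matrices, whose oscillation contracts over every
window of some fixed length converges to a constant vector. -/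
lemma exists_tendsto_of_oscillation_contracts {x : ℕ → ι → ℝ} {B : ℕ → Matrix ι ι ℝ}
    (hB : ∀ k, B k ∈ Matrix.rowStochastic ℝ ι) (hx : ∀ k, x (k + 1) = B k *ᵥ x k) {δ : ℝ}
    (hδ : 0 < δ) (m : ℕ) (hc : ∀ k, (⨆ i, x (k + m) i) - ⨅ i, x (k + m) i ≤
      (1 - δ) * ((⨆ i, x k i) - ⨅ i, x k i)) :
    ∃ c, ∀ i, Tendsto (fun k => x k i) atTop (𝓝 c) := by
  have hle : ∀ k i, x k i ≤ ⨆ i, x k i := fun k => le_ciSup (Set.finite_range _).bddAbove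
  have hge : ∀ k i, (⨅ i, x k i) ≤ x k i := fun k => ciInf_le (Set.finite_range _).bddBelow
  have hanti : Antitone fun k => ⨆ i, x k i := antitone_nat_of_succ_le fun k =>
    ciSup_le fun i => by rw [hx]; exact mulVec_le_of_mem_rowStochastic (hB k) (hle k) i
  have hmono : Monotone fun k => ⨅ i, x k i := monotone_nat_of_le_succ fun k =>
    le_ciInf fun i => by rw [hx]; exact le_mulVec_of_mem_rowStochastic (hB k) (hge k) i
  obtain ⟨i₀⟩ := ‹Nonempty ι›
  have hsup := tendsto_atTop_ciInf hanti
    ⟨⨅ i, x 0 i, by rintro _ ⟨k, rfl⟩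
                    exact (hmono k.zero_le).trans ((hge k i₀).trans (hle k i₀))⟩
  have hinf := tendsto_atTop_ciSup hmono
    ⟨⨆ i, x 0 i, by rintro _ ⟨k, rfl⟩
                    exact ((hge k i₀).trans (hle k i₀)).trans (hanti k.zero_le)⟩
  set M := ⨅ k, ⨆ i, x k i
  set c := ⨆ k, ⨅ i, x k i
  have hosc := hsup.sub hinf
  -- The contraction passes to the limit, where `δ > 0` leaves no room for a positive gap.
  have hlim : M - c ≤ (1 - δ) * (M - c) :=
    le_of_tendsto_of_tendsto' (hosc.comp (tendsto_add_atTop_nat m)) (hosc.const_mul _) hc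
  have hnn : 0 ≤ M - c := ge_of_tendsto' hosc fun k =>
    sub_nonneg.2 ((hge k i₀).trans (hle k i₀))
  have hMc : M = c := by nlinarith
  rw [hMc] at hsup
  exact ⟨c, fun i => tendsto_of_tendsto_of_tendsto_of_le_of_le hinf hsup
    (fun k => hge k i) (fun k => hle k i)⟩

end Oscillation

/-- Weak ergodicity: backward products of uniformly positive stochastic matrices on an ergodic
graph converge to a matrix with identical rows. -/
theorem exists_tendsto_aggProd {n : ℕ} (hn : 0 < n) {G : Digraph (Fin n)} (hG : IsErgodic G)
    {A : ℕ → Matrix (Fin n) (Fin n) ℝ} (hA : ∀ k, A k ∈ Matrix.rowStochastic ℝ (Fin n))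
    {ε : ℝ} (hε : 0 < ε) (hAG : ∀ k p q, G.Adj p q → ε ≤ A k p q) :
    ∃ y ∈ stdSimplex ℝ (Fin n), Tendsto (aggProd A) atTop (𝓝 (Matrix.vecMulVec 1 y)) := by
  have : Nonempty (Fin n) := ⟨⟨0, hn⟩⟩
  obtain ⟨m, -, hm⟩ := hG.isPrimitive.exists_pos_pow
  have hcol : ∀ (M N : Matrix (Fin n) (Fin n) ℝ) (j : Fin n),
      (fun i => (M * N) i j) = M *ᵥ fun i => N i j := fun _ _ _ => rfl
  have key : ∀ j, ∃ c, ∀ i, Tendsto (fun k => aggProd A k i j) atTop (𝓝 c) := fun j =>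
    exists_tendsto_of_oscillation_contracts (x := fun k i => aggProd A k i j) hA
      (fun k => hcol _ _ j) (pow_pos hε m) m fun k => by
        have h := iSup_sub_iInf_mulVec_le
          (aggProd_mem (A := fun r => A (k + r)) (fun r => hA (k + r)) m)
          (fun i l => pow_le_aggProd (A := fun r => A (k + r)) (fun r => hA (k + r)) hε.le
            (fun r => hAG (k + r)) m i l (hm i l)) (fun i => aggProd A k i j)
        rw [← hcol, ← aggProd_add] at h
        exact h
  choose y hy using key
  refine ⟨y, ⟨fun j => ?_, ?_⟩, ?_⟩
  · exact ge_of_tendsto' (hy j ⟨0, hn⟩) fun k => (aggProd_mem hA k).1 _ _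
  · refine tendsto_nhds_unique (tendsto_finsetSum _ fun j _ => hy j ⟨0, hn⟩) ?_
    simp only [Matrix.sum_row_of_mem_rowStochastic (aggProd_mem hA _)]
    exact tendsto_const_nhds
  · refine tendsto_pi_nhds.2 fun i => tendsto_pi_nhds.2 fun j => ?_
    simpa [Matrix.vecMulVec_apply] using hy j i

end Smoothing

namespace Smoothing

/-! ### The Dirichlet energy of normalized states -/

lemma rwLaplacian_mulVec_one {n : ℕ} {G : Digraph (Fin n)} (hG : ∀ i, ∃ j, G.Adj i j) :
    rwLaplacian G *ᵥ 1 = 0 := by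
  classical
  have hdet : IsUnit (degMatrix G).det := by
    rw [degMatrix, Matrix.det_diagonal, isUnit_iff_ne_zero, Finset.prod_ne_zero_iff]
    intro i _
    obtain ⟨j, hj⟩ := hG i
    have : Nonempty {j // G.Adj i j} := ⟨⟨j, hj⟩⟩
    exact_mod_cast Nat.card_pos.ne'
  have hdeg : adjMatrix G *ᵥ 1 = degMatrix G *ᵥ 1 := by
    ext i
    rw [degMatrix, Matrix.mulVec_diagonal]
    simp [Matrix.mulVec, dotProduct, adjMatrix, Fintype.card_subtype]
  rw [rwLaplacian, Matrix.sub_mulVec, Matrix.one_mulVec, ← Matrix.mulVec_mulVec, hdeg,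
    Matrix.mulVec_mulVec, Matrix.nonsing_inv_mul _ hdet, Matrix.one_mulVec, sub_self]

lemma rwEnergy_smul {n d : ℕ} (G : Digraph (Fin n)) (c : ℝ) (X : Matrix (Fin n) (Fin d) ℝ) :
    rwEnergy G (c • X) = c ^ 2 * rwEnergy G X := by
  simp only [rwEnergy, Matrix.transpose_smul, Matrix.smul_mul, Matrix.mul_smul, Matrix.trace_smul,
    smul_eq_mul]
  ring

lemma rwEnergy_vecMulVec_one {n d : ℕ} {G : Digraph (Fin n)} (hG : ∀ i, ∃ j, G.Adj i j)
    (z : Fin d → ℝ) : rwEnergy G (Matrix.vecMulVec 1 z) = 0 := by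
  rw [rwEnergy, Matrix.mul_assoc, Matrix.mul_vecMulVec, rwLaplacian_mulVec_one hG]
  simp

open scoped Matrix.Norms.Frobenius in
lemma frobNormalize_smul {n d : ℕ} {c : ℝ} (hc : 0 < c) (X : Matrix (Fin n) (Fin d) ℝ) :
    frobNormalize (c • X) = frobNormalize X := by
  rw [frobNormalize, frobNormalize, norm_smul, Real.norm_of_nonneg hc.le, smul_smul, mul_inv,
    mul_right_comm, inv_mul_cancel₀ hc.ne', one_mul]

lemma continuous_rwEnergy {n d : ℕ} (G : Digraph (Fin n)) :
    Continuous (rwEnergy G : Matrix (Fin n) (Fin d) ℝ → ℝ) := by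
  unfold rwEnergy
  fun_prop

open scoped Matrix.Norms.Frobenius in
lemma continuousAt_frobNormalize {n d : ℕ} {X : Matrix (Fin n) (Fin d) ℝ} (hX : X ≠ 0) :
    ContinuousAt frobNormalize X := by
  unfold frobNormalize
  exact (continuous_norm.continuousAt.inv₀ (norm_ne_zero_iff.2 hX)).smul continuousAt_id

/-- States that approach a nonzero state with equal rows lose their normalized energy. -/
lemma tendsto_rwEnergy_frobNormalize {n d : ℕ} {G : Digraph (Fin n)} (hG : ∀ i, ∃ j, G.Adj i j)
    {X : ℕ → Matrix (Fin n) (Fin d) ℝ} {z : Fin d → ℝ} (hz : Matrix.vecMulVec (1 : Fin n → ℝ) z ≠ 0)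
    (hX : Tendsto X atTop (𝓝 (Matrix.vecMulVec 1 z))) :
    Tendsto (fun l => rwEnergy G (frobNormalize (X l))) atTop (𝓝 0) := by
  have h := ((continuous_rwEnergy G).continuousAt.tendsto.comp
    (continuousAt_frobNormalize hz).tendsto).comp hX
  have h0 : rwEnergy G (frobNormalize (Matrix.vecMulVec (1 : Fin n → ℝ) z)) = 0 := by
    rw [frobNormalize, rwEnergy_smul, rwEnergy_vecMulVec_one hG, mul_zero]
  rw [h0] at h
  exact h

/-! ### Measurability -/

lemma measurable_matrix_iff {α : Type*} [MeasurableSpace α] {m n : ℕ}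
    {f : α → Matrix (Fin m) (Fin n) ℝ} : Measurable f ↔ ∀ i j, Measurable fun x => f x i j :=
  measurable_pi_iff.trans (forall_congr' fun _ => measurable_pi_iff)

lemma measurable_matrix_mul {α : Type*} [MeasurableSpace α] {m n k : ℕ}
    {f : α → Matrix (Fin m) (Fin n) ℝ} {g : α → Matrix (Fin n) (Fin k) ℝ}
    (hf : Measurable f) (hg : Measurable g) : Measurable fun x => f x * g x := by
  rw [measurable_matrix_iff] at *
  intro i j
  simp only [Matrix.mul_apply]
  exact Finset.measurable_sum _ fun l _ => (hf i l).mul (hg l j)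

lemma measurable_frobNormalize {n d : ℕ} :
    Measurable (frobNormalize : Matrix (Fin n) (Fin d) ℝ → _) := by
  have hid := measurable_matrix_iff.1 (measurable_id (α := Matrix (Fin n) (Fin d) ℝ))
  refine measurable_matrix_iff.2 fun i j => ?_
  simp only [frobNormalize, Matrix.frobenius_norm_def, Matrix.smul_apply, smul_eq_mul]
  refine Measurable.mul (Measurable.inv (Measurable.pow_const
    (Finset.measurable_sum _ fun i _ => Finset.measurable_sum _ fun j _ => ?_) _)) (hid i j)
  exact (hid i j).norm.pow_const _

lemma measurable_rwEnergy {n d : ℕ} (G : Digraph (Fin n)) :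
    Measurable (rwEnergy G : Matrix (Fin n) (Fin d) ℝ → ℝ) := by
  have hid : Measurable fun X : Matrix (Fin n) (Fin d) ℝ => X := measurable_id
  have htr : Measurable fun X : Matrix (Fin n) (Fin d) ℝ => Xᵀ :=
    measurable_matrix_iff.2 fun i j => measurable_matrix_iff.1 hid j i
  have h := measurable_matrix_iff.1
    (measurable_matrix_mul (measurable_matrix_mul htr (measurable_const (a := rwLaplacian G))) hid)
  exact Finset.measurable_sum Finset.univ fun i _ => h i i

/-! ### Convergence in measure -/

/-- The exceptional set is the kernel of a linear map that is nonzero on a suitable matrix unit,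
hence a proper subspace and Lebesgue-null. -/
lemma ae_vecMul_vecMul_ne_zero {m d : ℕ} {t : Fin m → ℝ} (ht : t ≠ 0)
    {U : Matrix (Fin d) (Fin d) ℝ} (hU : U ≠ 0) :
    ∀ᵐ Z : Matrix (Fin m) (Fin d) ℝ, t ᵥ* Z ᵥ* U ≠ 0 := by
  let φ : Matrix (Fin m) (Fin d) ℝ →ₗ[ℝ] (Fin d → ℝ) :=
    { toFun := fun Z => t ᵥ* Z ᵥ* U
      map_add' := fun Z Z' => by rw [Matrix.vecMul_add, Matrix.add_vecMul]
      map_smul' := fun c Z => by rw [Matrix.vecMul_smul, Matrix.smul_vecMul, RingHom.id_apply] }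
  have hker : LinearMap.ker φ ≠ ⊤ := by
    rw [Ne, LinearMap.ker_eq_top]
    intro h
    obtain ⟨a, ha⟩ := Function.ne_iff.1 ht
    obtain ⟨b, hb⟩ := Function.ne_iff.1 hU
    obtain ⟨c, hc⟩ := Function.ne_iff.1 hb
    have h0 : (t ᵥ* Matrix.vecMulVec (Pi.single a 1) (Pi.single b 1) ᵥ* U) c = 0 :=
      congrFun (LinearMap.congr_fun h (Matrix.vecMulVec (Pi.single a 1) (Pi.single b 1))) c
    rw [Matrix.vecMul_vecMulVec, Matrix.smul_vecMul] at h0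
    simp at h0
    exact h0.elim ha hc
  exact measure_eq_zero_iff_ae_notMem.1 (Measure.addHaar_submodule
    (E := Fin m → Fin d → ℝ) volume (LinearMap.ker φ) hker)

/-- Every sequence in a finite-dimensional space is a nonnegative multiple of a sequence all of
whose subsequences have a nonzero cluster point. -/
lemma exists_smul_eq_and_subseq_tendsto {E : Type*} [NormedAddCommGroup E] [NormedSpace ℝ E]
    [FiniteDimensional ℝ E] [Nontrivial E] (v : ℕ → E) :
    ∃ (c : ℕ → ℝ) (u : ℕ → E), (∀ l, 0 ≤ c l ∧ v l = c l • u l) ∧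
      ∀ ns : ℕ → ℕ, ∃ u₀ ≠ 0, ∃ ms : ℕ → ℕ, StrictMono ms ∧
        Tendsto (fun k => u (ns (ms k))) atTop (𝓝 u₀) := by
  have hunit : ∀ x : E, ∃ u : E, ‖u‖ = 1 ∧ x = ‖x‖ • u := by
    intro x
    rcases eq_or_ne x 0 with rfl | hx
    · obtain ⟨u, hu⟩ := exists_norm_eq E zero_le_one
      exact ⟨u, hu, by simp⟩
    · have h := norm_ne_zero_iff.2 hx
      exact ⟨‖x‖⁻¹ • x, by rw [norm_smul, norm_inv, norm_norm, inv_mul_cancel₀ h],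
        by rw [smul_smul, mul_inv_cancel₀ h, one_smul]⟩
  choose u hu hvu using fun l => hunit (v l)
  refine ⟨fun l => ‖v l‖, u, fun l => ⟨norm_nonneg _, hvu l⟩, fun ns => ?_⟩
  have := FiniteDimensional.proper ℝ E
  obtain ⟨u₀, hu₀, ms, hms, hlim⟩ := (isCompact_sphere (0 : E) 1).tendsto_subseq
    (x := fun k => u (ns k)) fun k => by simpa using hu (ns k)
  refine ⟨u₀, ?_, ms, hms, hlim⟩
  rintro rfl
  simp at hu₀

lemma measurable_energy {n m d : ℕ} (G : Digraph (Fin n)) (S : Matrix (Fin n) (Fin m) ℝ)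
    {α : Type*} [MeasurableSpace α] {Z : α → Matrix (Fin m) (Fin d) ℝ}
    {V : α → Matrix (Fin d) (Fin d) ℝ} (hZ : Measurable Z) (hV : Measurable V) :
    Measurable fun x => rwEnergy G (frobNormalize (S * Z x * V x)) :=
  (measurable_rwEnergy G).comp <| measurable_frobNormalize.comp <|
    measurable_matrix_mul (measurable_matrix_mul measurable_const hZ) hV

lemma tendsto_matrix_mul {n m d : ℕ} {α : Type*} {f : Filter α}
    {S : α → Matrix (Fin n) (Fin m) ℝ} {S₀ : Matrix (Fin n) (Fin m) ℝ}
    {U : α → Matrix (Fin m) (Fin d) ℝ} {U₀ : Matrix (Fin m) (Fin d) ℝ}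
    (hS : Tendsto S f (𝓝 S₀)) (hU : Tendsto U f (𝓝 U₀)) :
    Tendsto (fun a => S a * U a) f (𝓝 (S₀ * U₀)) := by
  refine tendsto_pi_nhds.2 fun i => tendsto_pi_nhds.2 fun j => ?_
  simp only [Matrix.mul_apply]
  exact tendsto_finsetSum _ fun a _ =>
    ((hS.apply_nhds i).apply_nhds a).mul ((hU.apply_nhds a).apply_nhds j)

/-- Deterministic transformations and a random state with an absolutely continuous law: along a
subsequence the normalized transformations converge, and the energy vanishes almost surely. -/
theorem tendstoInMeasure_energy_of_deterministic {n m d : ℕ} (hn : 0 < n) {G : Digraph (Fin n)}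
    (hG : ∀ i, ∃ j, G.Adj i j) {S : ℕ → Matrix (Fin n) (Fin m) ℝ} {t : Fin m → ℝ} (ht : t ≠ 0)
    (hS : Tendsto S atTop (𝓝 (Matrix.vecMulVec 1 t))) (V : ℕ → Matrix (Fin d) (Fin d) ℝ)
    (μ : Measure (Matrix (Fin m) (Fin d) ℝ)) [IsFiniteMeasure μ] (hμ : μ ≪ volume) :
    TendstoInMeasure μ (fun l Z => rwEnergy G (frobNormalize (S l * Z * V l)))
      atTop (fun _ => 0) := by
  rcases Nat.eq_zero_or_pos d with rfl | hd
  · intro η hη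
    simp [rwEnergy, Matrix.trace, hη.ne']
  have : Nonempty (Fin d) := ⟨⟨0, hd⟩⟩
  obtain ⟨c, U, hVU, hU⟩ : ∃ (c : ℕ → ℝ) (U : ℕ → Matrix (Fin d) (Fin d) ℝ),
      (∀ l, 0 ≤ c l ∧ V l = c l • U l) ∧ ∀ ns : ℕ → ℕ, ∃ U₀ ≠ 0, ∃ ms : ℕ → ℕ, StrictMono ms ∧
        Tendsto (fun k => U (ns (ms k))) atTop (𝓝 U₀) :=
    exists_smul_eq_and_subseq_tendsto (E := Fin d → Fin d → ℝ) V
  have hle : ∀ l (Z : Matrix (Fin m) (Fin d) ℝ), ‖rwEnergy G (frobNormalize (S l * Z * V l))‖ ≤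
      ‖rwEnergy G (frobNormalize (S l * Z * U l))‖ := by
    intro l Z
    -- If `c l = 0`, the left side vanishes while `U l` is an unrelated direction, so only an
    -- inequality is available.
    rcases (hVU l).1.eq_or_lt with h | h
    · rw [(hVU l).2, ← h, zero_smul]
      have h0 : rwEnergy G (frobNormalize (0 : Matrix (Fin n) (Fin d) ℝ)) = 0 := by
        simp [frobNormalize, rwEnergy]
      rw [Matrix.mul_zero, h0, norm_zero]
      exact norm_nonneg _
    · conv_lhs => rw [(hVU l).2, Matrix.mul_smul, frobNormalize_smul h]
  suffices h : TendstoInMeasure μ (fun l Z => rwEnergy G (frobNormalize (S l * Z * U l)))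
      atTop (fun _ => 0) by
    rw [tendstoInMeasure_iff_norm] at h ⊢
    intro η hη
    refine tendsto_of_tendsto_of_tendsto_of_le_of_le tendsto_const_nhds (h η hη)
      (fun _ => zero_le) fun l => measure_mono fun Z hZ => ?_
    simp only [sub_zero, Set.mem_ofPred_eq] at hZ ⊢
    exact hZ.trans (hle l Z)
  intro η hη
  refine tendsto_of_subseq_tendsto fun ns hns => ?_
  obtain ⟨U₀, hne, ms, hms, hlim⟩ := hU ns
  refine ⟨ms, ?_⟩
  have hae : ∀ᵐ Z ∂μ, Tendsto (fun k =>
      rwEnergy G (frobNormalize (S (ns (ms k)) * Z * U (ns (ms k))))) atTop (𝓝 0) := by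
    filter_upwards [hμ.ae_le (ae_vecMul_vecMul_ne_zero ht hne)] with Z hZ
    refine tendsto_rwEnergy_frobNormalize hG (z := t ᵥ* Z ᵥ* U₀) ?_ ?_
    · intro h
      refine hZ (funext fun j => ?_)
      simpa [Matrix.vecMulVec_apply] using congrFun (congrFun h ⟨0, hn⟩) j
    · rw [← Matrix.vecMulVec_mul, ← Matrix.vecMulVec_mul]
      exact tendsto_matrix_mul (tendsto_matrix_mul (hS.comp (hns.comp hms.tendsto_atTop))
        tendsto_const_nhds) hlim
  exact tendstoInMeasure_of_tendsto_ae (fun k => (measurable_energy G _ measurable_id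
    measurable_const).aestronglyMeasurable) hae η hη

/-- The transformations may be random, as long as they are independent of the random state. -/
theorem tendstoInMeasure_energy {n m d : ℕ} (hn : 0 < n) {G : Digraph (Fin n)}
    (hG : ∀ i, ∃ j, G.Adj i j) {S : ℕ → Matrix (Fin n) (Fin m) ℝ} {t : Fin m → ℝ} (ht : t ≠ 0)
    (hS : Tendsto S atTop (𝓝 (Matrix.vecMulVec 1 t)))
    {Ω β : Type*} [MeasurableSpace Ω] [MeasurableSpace β] (P : Measure Ω) [IsProbabilityMeasure P]
    {Z : Ω → Matrix (Fin m) (Fin d) ℝ} (hZ : Measurable Z) (hac : P.map Z ≪ volume)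
    {w : Ω → β} (hw : Measurable w) (hind : IndepFun Z w P)
    {V : ℕ → β → Matrix (Fin d) (Fin d) ℝ} (hV : ∀ l, Measurable (V l)) :
    TendstoInMeasure P (fun l ω => rwEnergy G (frobNormalize (S l * Z ω * V l (w ω))))
      atTop (fun _ => 0) := by
  have : IsProbabilityMeasure (P.map Z) := Measure.isProbabilityMeasure_map hZ.aemeasurable
  have : IsProbabilityMeasure (P.map w) := Measure.isProbabilityMeasure_map hw.aemeasurable
  intro η hη
  let F : ℕ → Matrix (Fin m) (Fin d) ℝ × β → ℝ :=
    fun l p => rwEnergy G (frobNormalize (S l * p.1 * V l p.2))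
  have hE : ∀ l, MeasurableSet {p | η ≤ edist (F l p) 0} := fun l =>
    measurableSet_le measurable_const
      ((measurable_energy G (S l) measurable_fst ((hV l).comp measurable_snd)).edist
        measurable_const)
  -- By independence the joint law is a product, so the probability averages the deterministic case
  -- over the law of `w`.
  have hEq : ∀ l, P {ω | η ≤ edist (F l (Z ω, w ω)) 0} =
      ∫⁻ b, P.map Z {z | η ≤ edist (F l (z, b)) 0} ∂(P.map w) := by
    intro l
    have h := Measure.prod_apply_symm (hE l) (μ := P.map Z) (ν := P.map w)
    rw [← (indepFun_iff_map_prod_eq_prod_map_map hZ.aemeasurable hw.aemeasurable).1 hind,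
      Measure.map_apply (hZ.prodMk hw) (hE l)] at h
    exact h
  have hlim : Tendsto (fun l => ∫⁻ b, P.map Z {z | η ≤ edist (F l (z, b)) 0} ∂(P.map w))
      atTop (𝓝 (∫⁻ _, 0 ∂(P.map w))) := by
    refine tendsto_lintegral_of_dominated_convergence (fun _ => 1)
      (fun l => measurable_measure_prodMk_right (hE l)) (fun l => ae_of_all _ fun b => prob_le_one)
      (by simp) (ae_of_all _ fun b => ?_)
    exact tendstoInMeasure_energy_of_deterministic hn hG ht hS (fun l => V l b) _ hac η hη
  rw [lintegral_zero] at hlim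
  exact hlim.congr fun l => (hEq l).symm

/-! ### Unrolling the recursion -/

/-- The product `W⁽⁰⁾ W⁽¹⁾ ⋯ W⁽ˡ⁻¹⁾` of the first `l` feature transformations. -/
def featProd {d : ℕ} (W : ℕ → Matrix (Fin d) (Fin d) ℝ) : ℕ → Matrix (Fin d) (Fin d) ℝ
  | 0 => 1
  | k + 1 => featProd W k * W k

lemma features_eq {n d : ℕ} (A : ℕ → Matrix (Fin n) (Fin n) ℝ)
    (W : ℕ → Matrix (Fin d) (Fin d) ℝ) (X₀ : Matrix (Fin n) (Fin d) ℝ) (l : ℕ) :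
    features A W X₀ l = aggProd A l * X₀ * featProd W l := by
  induction l with
  | zero => simp [features, aggProd, featProd]
  | succ l ih => simp only [features, aggProd, featProd, ih, Matrix.mul_assoc]

lemma featProd_succ {d : ℕ} (W : ℕ → Matrix (Fin d) (Fin d) ℝ) (l : ℕ) :
    featProd W (l + 1) = W 0 * featProd (fun k => W (k + 1)) l := by
  induction l with
  | zero => simp [featProd]
  | succ l ih => rw [featProd, ih, featProd, Matrix.mul_assoc]

lemma measurable_featProd {d : ℕ} (l : ℕ) :
    Measurable fun W : ℕ → Matrix (Fin d) (Fin d) ℝ => featProd W l := by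
  induction l with
  | zero => exact measurable_const
  | succ l ih => exact measurable_matrix_mul ih (measurable_pi_apply l)

end Smoothing

theorem proposition5p7 {n d : ℕ} (hn : 0 < n)
    (G : Digraph (Fin n)) (hG : Smoothing.IsErgodic G)
    (A : ℕ → Matrix (Fin n) (Fin n) ℝ)
    (hA : ∀ k, A k ∈ Matrix.rowStochastic ℝ (Fin n))
    (hAG : ∀ k p q, A k p q ≠ 0 ↔ G.Adj p q)
    (ε : ℝ) (hε : 0 < ε) (hAε : ∀ k p q, A k p q ≠ 0 → ε ≤ A k p q)
    {Ω : Type*} [MeasurableSpace Ω] (P : Measure Ω) [IsProbabilityMeasure P] :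
    -- generic initial state, arbitrary (deterministic or random) feature transformations
    (∀ (X₀ : Ω → Matrix (Fin n) (Fin d) ℝ) (W : ℕ → Ω → Matrix (Fin d) (Fin d) ℝ),
      Measurable X₀ → (∀ k, Measurable (W k)) →
      P.map X₀ ≪ volume →
      IndepFun X₀ (fun ω k => W k ω) P →
      TendstoInMeasure P
        (fun (l : ℕ) ω => Smoothing.rwEnergy G
          (Smoothing.frobNormalize (Smoothing.features A (fun k => W k ω) (X₀ ω) l)))
        atTop (fun _ => 0)) ∧
    -- fixed initial state with a component in the dominating subspace, generic transformations
    (∃ y ∈ stdSimplex ℝ (Fin n),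
      Tendsto (Smoothing.aggProd A) atTop (𝓝 (Matrix.vecMulVec 1 y)) ∧
      ∀ (X₀ : Matrix (Fin n) (Fin d) ℝ) (W : ℕ → Ω → Matrix (Fin d) (Fin d) ℝ),
        y ᵥ* X₀ ≠ 0 → (∀ k, Measurable (W k)) →
        P.map (W 0) ≪ volume →
        IndepFun (W 0) (fun ω k => W (k + 1) ω) P →
        TendstoInMeasure P
          (fun (l : ℕ) ω => Smoothing.rwEnergy G
            (Smoothing.frobNormalize (Smoothing.features A (fun k => W k ω) X₀ l)))
          atTop (fun _ => 0)) := by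

  have hε' : ∀ k p q, G.Adj p q → ε ≤ A k p q := fun k p q h => hAε k p q ((hAG k p q).2 h)
  have hrow : ∀ i, ∃ j, G.Adj i j := by
    intro i
    have hsum : ∑ j, A 0 i j ≠ 0 := by
      rw [Matrix.sum_row_of_mem_rowStochastic (hA 0)]
      exact one_ne_zero
    obtain ⟨j, -, hj⟩ := Finset.exists_ne_zero_of_sum_ne_zero hsum
    exact ⟨j, (hAG 0 i j).1 hj⟩
  obtain ⟨y, hy, hlim⟩ := Smoothing.exists_tendsto_aggProd hn hG hA hε hε'
  have hy0 : y ≠ 0 := by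
    rintro rfl
    simpa using hy.2
  refine ⟨fun X₀ W hX₀ hW hac hind => ?_, y, hy, hlim, fun X₀ W hyX hW hac hind => ?_⟩
  · simp only [Smoothing.features_eq]
    exact Smoothing.tendstoInMeasure_energy hn hrow hy0 hlim P hX₀ hac
      (w := fun ω k => W k ω) (measurable_pi_iff.2 hW) hind
      (V := fun l W => Smoothing.featProd W l) Smoothing.measurable_featProd
  · have hlim' : Tendsto (fun l => Smoothing.aggProd A (l + 1)) atTop (𝓝 (Matrix.vecMulVec 1 y)) :=
      (tendsto_add_atTop_iff_nat 1).2 hlim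
    have hS : Tendsto (fun l => Smoothing.aggProd A (l + 1) * X₀) atTop
        (𝓝 (Matrix.vecMulVec 1 y * X₀)) :=
      Smoothing.tendsto_matrix_mul (S := fun l => Smoothing.aggProd A (l + 1)) hlim'
        tendsto_const_nhds
    rw [Matrix.vecMulVec_mul] at hS
    have key := Smoothing.tendstoInMeasure_energy hn hrow hyX hS P (hW 0) hac
      (w := fun ω k => W (k + 1) ω) (measurable_pi_iff.2 fun k => hW (k + 1)) hind
      (V := fun l W => Smoothing.featProd W l) Smoothing.measurable_featProd
    intro η hη
    -- The factor `W 0` is present only from index one on.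
    rw [← tendsto_add_atTop_iff_nat 1]
    have heq : ∀ l ω, Smoothing.features A (fun k => W k ω) X₀ (l + 1) =
        Smoothing.aggProd A (l + 1) * X₀ * W 0 ω *
          Smoothing.featProd (fun k => W (k + 1) ω) l := fun l ω => by
      rw [Smoothing.features_eq, Smoothing.featProd_succ, ← Matrix.mul_assoc]
    simp only [heq]
    exact key η hη
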